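/- A \emph{$\ast$-category} is a category with an involution assigning to each $f\colon X\to Y$ a morphism $f^\ast\colon Y\to X$ such that $1^\ast=1$, $(gf)^\ast=f^\ast g^\ast$ and $f^{\ast\ast}=f$. A morphism $f$ is \emph{isometric} if $f^\ast f=1$ and \emph{coisometric} if $ff^\ast=1$; a binary product $(r_1\colon X\to X_1,\ r_2\colon X\to X_2)$ is \emph{orthonormal} if $r_1,r_2$ are coisometric and $r_1r_2^\ast=0$. A \emph{pre-Hilbert $\ast$-category} is a $\ast$-category with a zero object, binary orthonormal products and isometric kernels (every morphism has a kernel that is isometric), in which every diagonal $\langle 1,1\rangle\colon X\to X\oplus X$ (into an orthonormal product) is a kernel. Such a category is canonically enriched in abelian groups. For Hermitian $f,g\in\mathcal C(A,A)$ write $f\le g$ if $g-f=h^\ast h$ for some morphism $h\colon A\to X$; upper bounds and suprema below are with respect to this order. A morphism $f$ is a \emph{contraction} if $f^\ast f\le 1$. Let $\mathcal C$ be a pre-Hilbert $\ast$-category. A family $(x_j\colon A\to X)_{j\in J}$ of parallel morphisms indexed by a set is \emph{orthogonal} if $x_j^\ast x_k=0$ for $j\ne k$; it is an \emph{$\ell^2$-family}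 if, moreover, the net $\bigl(\sum_{j\in F}x_j^\ast x_j\bigr)_F$, indexed by the finite subsets $F\subseteq J$, is bounded above in $\mathcal C(A,A)$. An \emph{order sum} of such a family is a morphism $s\colon A\to X$ with $s^\ast x_j=x_j^\ast x_j$ for all $j\in J$ and $s^\ast s=\sup_F\sum_{j\in F}x_j^\ast x_j$. The category $\mathcal C$ is \emph{orthogonally complete} if for all objects $A,X$ every $\ell^2$-family of morphisms $A\to X$ has an order sum. An \emph{$\ell^2$-span} on a family of objects $(X_j)_{j\in J}$ is a family $(g_j\colon Y\to X_j)_{j\in J}$ for which the net $\bigl(\sum_{j\in F}g_j^\ast g_j\bigr)_F$ is bounded above. An \emph{$\ell^2$-product} of $(X_j)_{j\in J}$ is an $\ell^2$-span $(r_j\colon P\to X_j)_{j\in J}$ such that for each $\ell^2$-span $(g_j\colon Y\to X_j)_{j\in J}$ there is a unique $g\colon Y\to P$ with $r_jg=g_j$ for all $j$, and this $g$ satisfies $g^\ast g=\sup_F\sum_{j\in F}g_j^\ast g_j$. For a codirected diagram of contractions $(f_{j\le k}\colon X_k\to X_j)_{j,k\in J}$, where $J$ is a non-empty directed preordered set,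 an \emph{$\ell^2$-cone} is a cone $(g_j\colon Y\to X_j)_{j\in J}$ for which the net $(g_j^\ast g_j)_{j\in J}$ is bounded above; an \emph{$\ell^2$-limit} is an $\ell^2$-cone $(f_j\colon X\to X_j)_{j\in J}$ such that for each $\ell^2$-cone $(g_j\colon Y\to X_j)_{j\in J}$ there is a unique $g\colon Y\to X$ with $f_jg=g_j$ for all $j$, and this $g$ satisfies $g^\ast g=\sup_j g_j^\ast g_j$. A \emph{Hilbert $\ast$-category} is a pre-Hilbert $\ast$-category in which every codirected diagram of contractions has an $\ell^2$-limit. \textbf{Proposition.} Every pre-Hilbert $\ast$-category in which all set-indexed families of objects have $\ell^2$-products is orthogonally complete. \textbf{Corollary.} Every Hilbert $\ast$-category is orthogonally complete. -/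

import Mathlib

open CategoryTheory CategoryTheory.Limits

universe w v u

/-! Composition is written diagrammatically: `f ≫ g` is the composite usually written `g f`.
In particular `g ≫ adj f` is the morphism `f* g`. -/

namespace HilbertStar

/-- A ∗-category: a category with a contravariant identity-on-objects involution. -/
class StarCategory (C : Type u) [Category.{v} C] where
  /-- the involution `f ↦ f*` -/
  adj : ∀ {X Y : C}, (X ⟶ Y) → (Y ⟶ X)
  adj_id : ∀ X : C, adj (𝟙 X) = 𝟙 X
  adj_comp : ∀ {X Y Z : C} (f : X ⟶ Y) (g : Y ⟶ Z), adj (f ≫ g) = adj g ≫ adj f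
  adj_adj : ∀ {X Y : C} (f : X ⟶ Y), adj (adj f) = f


section Basic

variable {C : Type u} [Category.{v} C] [StarCategory C]

/-- `f* f = 1`. -/
def IsIsometric {X Y : C} (f : X ⟶ Y) : Prop := f ≫ StarCategory.adj f = 𝟙 X

/-- `f f* = 1`. -/
def IsCoisometric {X Y : C} (f : X ⟶ Y) : Prop := StarCategory.adj f ≫ f = 𝟙 Y

/-- `(r₁, r₂)` is an orthonormal (binary) product of `X` and `Y`: it is a product, both
projections are coisometries, and `r₁ r₂* = 0`. -/
structure IsOrthonormalProduct [HasZeroMorphisms C] {X Y P : C} (r₁ : P ⟶ X) (r₂ : P ⟶ Y) :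
    Prop where
  isProduct : Nonempty (IsLimit (BinaryFan.mk r₁ r₂))
  fst_coisometric : IsCoisometric r₁
  snd_coisometric : IsCoisometric r₂
  orthogonal : StarCategory.adj r₂ ≫ r₁ = 0

end Basic

/-- `k` is a kernel of `f`. -/
def IsKernelOf {C : Type u} [Category.{v} C] [HasZeroMorphisms C] {K X Y : C}
    (k : K ⟶ X) (f : X ⟶ Y) : Prop :=
  ∃ w : k ≫ f = 0, Nonempty (IsLimit (KernelFork.ofι k w))

/-- A pre-Hilbert ∗-category: a ∗-category with a zero object, binary orthonormal products and
isometric kernels, in which every diagonal `⟨1, 1⟩ : X ⟶ X ⊕ X` is a kernel. (The zero morphisms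
are uniquely determined by the existence of a zero object.) -/
class PreHilbertStarCategory (C : Type u) [Category.{v} C] extends
    StarCategory C, HasZeroMorphisms C where
  exists_zeroObject : HasZeroObject C
  exists_orthonormalProduct : ∀ X Y : C, ∃ (P : C) (r₁ : P ⟶ X) (r₂ : P ⟶ Y),
    IsOrthonormalProduct r₁ r₂
  exists_isometric_kernel : ∀ {X Y : C} (f : X ⟶ Y), ∃ (K : C) (k : K ⟶ X),
    IsIsometric k ∧ IsKernelOf k f
  diagonal_isKernel : ∀ {X P : C} (r₁ r₂ : P ⟶ X), IsOrthonormalProduct r₁ r₂ →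
    ∀ d : X ⟶ P, d ≫ r₁ = 𝟙 X → d ≫ r₂ = 𝟙 X → ∃ (T : C) (t : P ⟶ T), IsKernelOf d t

open StarCategory

/-! ### The canonical enrichment in abelian groups

Orthonormal products are biproducts, so the hom-sets carry Mathlib's canonical addition
`f + g = (X ⟶ X ⊞ X ⟶ Y)`; normality of the diagonals provides negatives. -/

section Additive

variable {C : Type u} [Category.{v} C]

section Star

variable [StarCategory C]

theorem adj_injective {X Y : C} {f g : X ⟶ Y} (h : adj f = adj g) : f = g := by
  rw [← adj_adj f, h, adj_adj]

variable [HasZeroMorphisms C]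

theorem adj_zero (X Y : C) : adj (0 : X ⟶ Y) = 0 := by
  have h2 : adj (0 : X ⟶ Y) = adj (0 : X ⟶ Y) ≫ (0 : X ⟶ X) := by
    apply adj_injective
    rw [adj_comp, adj_adj]
    simp
  rw [h2, comp_zero]

variable {X Y P : C} {r₁ : P ⟶ X} {r₂ : P ⟶ Y}

theorem IsOrthonormalProduct.orthogonal' (h : IsOrthonormalProduct r₁ r₂) :
    adj r₁ ≫ r₂ = 0 := by
  apply adj_injective
  rw [adj_comp, adj_adj, h.orthogonal, adj_zero]

theorem IsOrthonormalProduct.hom_ext (h : IsOrthonormalProduct r₁ r₂) {Z : C} {f g : Z ⟶ P}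
    (h₁ : f ≫ r₁ = g ≫ r₁) (h₂ : f ≫ r₂ = g ≫ r₂) : f = g :=
  BinaryFan.IsLimit.hom_ext h.isProduct.some h₁ h₂

theorem IsOrthonormalProduct.hom_ext' (h : IsOrthonormalProduct r₁ r₂) {Z : C} {f g : P ⟶ Z}
    (h₁ : adj r₁ ≫ f = adj r₁ ≫ g) (h₂ : adj r₂ ≫ f = adj r₂ ≫ g) : f = g := by
  apply adj_injective
  apply h.hom_ext
  · apply adj_injective
    rw [adj_comp, adj_comp, adj_adj, adj_adj, h₁]
  · apply adj_injective
    rw [adj_comp, adj_comp, adj_adj, adj_adj, h₂]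

theorem IsOrthonormalProduct.exists_lift (h : IsOrthonormalProduct r₁ r₂) {Z : C}
    (f : Z ⟶ X) (g : Z ⟶ Y) : ∃ l : Z ⟶ P, l ≫ r₁ = f ∧ l ≫ r₂ = g := by
  obtain ⟨l, h₁, h₂⟩ := BinaryFan.IsLimit.lift' h.isProduct.some f g
  exact ⟨l, h₁, h₂⟩

theorem IsOrthonormalProduct.exists_desc (h : IsOrthonormalProduct r₁ r₂) {Z : C}
    (f : X ⟶ Z) (g : Y ⟶ Z) : ∃ l : P ⟶ Z, adj r₁ ≫ l = f ∧ adj r₂ ≫ l = g := by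
  obtain ⟨l, h₁, h₂⟩ := h.exists_lift (adj f) (adj g)
  refine ⟨adj l, ?_, ?_⟩
  · rw [← adj_comp, h₁, adj_adj]
  · rw [← adj_comp, h₂, adj_adj]

theorem IsOrthonormalProduct.hasBinaryBiproduct (h : IsOrthonormalProduct r₁ r₂) :
    HasBinaryBiproduct X Y :=
  HasBinaryBiproduct.mk
    { bicone :=
        { pt := P
          fst := r₁
          snd := r₂
          inl := adj r₁
          inr := adj r₂
          inl_fst := h.fst_coisometric
          inl_snd := h.orthogonal'
          inr_fst := h.orthogonal
          inr_snd := h.snd_coisometric }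
      isBilimit :=
        { isLimit := h.isProduct.some
          isColimit := BinaryCofan.IsColimit.mk _
            (fun f g => (h.exists_desc f g).choose)
            (fun f g => (h.exists_desc f g).choose_spec.1)
            (fun f g => (h.exists_desc f g).choose_spec.2)
            (fun f g _ h₁ h₂ => h.hom_ext'
              (h₁.trans (h.exists_desc f g).choose_spec.1.symm)
              (h₂.trans (h.exists_desc f g).choose_spec.2.symm)) } }

end Star

variable [PreHilbertStarCategory C]

instance : HasZeroObject C := PreHilbertStarCategory.exists_zeroObject

instance : HasBinaryBiproducts C where
  has_binary_biproduct X Y := by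
    obtain ⟨_, _, _, h⟩ := PreHilbertStarCategory.exists_orthonormalProduct X Y
    exact h.hasBinaryBiproduct

/-- The canonical addition of parallel morphisms (existing in any category with binary
biproducts). -/
noncomputable abbrev homAddCommMonoid (X Y : C) : AddCommMonoid (X ⟶ Y) :=
  SemiadditiveOfBinaryBiproducts.addCommMonoidHomOfHasBinaryBiproducts X Y

theorem exists_neg_id (X : C) : ∃ n : X ⟶ X, (homAddCommMonoid X X).add n (𝟙 X) = 0 := by
  let _ (X Y : C) : AddCommMonoid (X ⟶ Y) := homAddCommMonoid X Y
  have ac {X Y Z : C} (f g : X ⟶ Y) (h : Y ⟶ Z) : (f + g) ≫ h = f ≫ h + g ≫ h :=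
    SemiadditiveOfBinaryBiproducts.add_comp f g h
  have ca {X Y Z : C} (f : X ⟶ Y) (g h : Y ⟶ Z) : f ≫ (g + h) = f ≫ g + f ≫ h :=
    SemiadditiveOfBinaryBiproducts.comp_add f g h
  have z0 {X Y Z : C} (f : X ⟶ Y) : f ≫ (0 : Y ⟶ Z) = 0 := comp_zero
  have z1 {X Y Z : C} (f : Y ⟶ Z) : (0 : X ⟶ Y) ≫ f = 0 := zero_comp
  -- orthonormal product `P` of two copies of `X`
  obtain ⟨P, p₁, p₂, hP⟩ := PreHilbertStarCategory.exists_orthonormalProduct X X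
  have e11 : adj p₁ ≫ p₁ = 𝟙 X := hP.fst_coisometric
  have e22 : adj p₂ ≫ p₂ = 𝟙 X := hP.snd_coisometric
  have e12 : adj p₁ ≫ p₂ = 0 := hP.orthogonal'
  have e21 : adj p₂ ≫ p₁ = 0 := hP.orthogonal
  obtain ⟨d, hd₁, hd₂⟩ := hP.exists_lift (𝟙 X) (𝟙 X)
  obtain ⟨T, t, htw, ⟨ht⟩⟩ := PreHilbertStarCategory.diagonal_isKernel p₁ p₂ hP d hd₁ hd₂
  have hd1 : adj p₁ ≫ adj d = 𝟙 X := by rw [← adj_comp, hd₁, adj_id]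
  have hd2 : adj p₂ ≫ adj d = 𝟙 X := by rw [← adj_comp, hd₂, adj_id]
  have hda : adj d = p₁ + p₂ := by
    apply hP.hom_ext'
    · rw [hd1, ca, e11, e12, add_zero]
    · rw [hd2, ca, e21, e22, zero_add]
  have hid : 𝟙 P = p₁ ≫ adj p₁ + p₂ ≫ adj p₂ := by
    apply hP.hom_ext
    · rw [ac, Category.assoc, Category.assoc, e11, e21, z0, add_zero, Category.id_comp,
        Category.comp_id]
    · rw [ac, Category.assoc, Category.assoc, e12, e22, z0, zero_add, Category.id_comp,
        Category.comp_id]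
  obtain ⟨K, k, hk, hkw, ⟨hkl⟩⟩ := PreHilbertStarCategory.exists_isometric_kernel (adj d)
  -- the diagonal is a kernel of `adj k`
  have key {W : C} (z : W ⟶ P) (hz : z ≫ adj k = 0) : ∃ y : W ⟶ X, y ≫ d = z := by
    have h1 : adj t ≫ adj d = 0 := by rw [← adj_comp, htw, adj_zero]
    obtain ⟨s, hs⟩ := KernelFork.IsLimit.lift' hkl (adj t) h1
    have hs' : s ≫ k = adj t := hs
    have h2 : z ≫ t = 0 := by
      rw [← adj_adj t, ← hs', adj_comp, ← Category.assoc, hz, z1]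
    obtain ⟨y, hy⟩ := KernelFork.IsLimit.lift' ht z h2
    exact ⟨y, hy⟩
  obtain ⟨u, hu⟩ : ∃ u, u = k ≫ p₁ := ⟨_, rfl⟩
  obtain ⟨v, hv⟩ : ∃ v, v = k ≫ p₂ := ⟨_, rfl⟩
  obtain ⟨a, ha⟩ : ∃ a, a = adj p₁ ≫ adj k := ⟨_, rfl⟩
  obtain ⟨b, hb⟩ : ∃ b, b = adj p₂ ≫ adj k := ⟨_, rfl⟩
  have huv : u + v = 0 := by rw [hu, hv, ← ca, ← hda, hkw]
  have hdk : d ≫ adj k = 0 := by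
    apply adj_injective
    rw [adj_comp, adj_adj, hkw, adj_zero]
  have hdp : d = adj p₁ + adj p₂ := by
    apply hP.hom_ext
    · rw [hd₁, ac, e11, e21, add_zero]
    · rw [hd₂, ac, e12, e22, zero_add]
  have hab : a + b = 0 := by rw [ha, hb, ← ac, ← hdp, hdk]
  have hk' : adj k = p₁ ≫ a + p₂ ≫ b := by
    calc adj k = 𝟙 P ≫ adj k := (Category.id_comp _).symm
      _ = _ := by rw [hid, ac, ha, hb, Category.assoc, Category.assoc]
  have h1 : u ≫ a + v ≫ b = 𝟙 K := by
    have : k ≫ adj k = 𝟙 K := hk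
    rw [← this, hu, hv, hk', ca, Category.assoc, Category.assoc]
  have h2 : u ≫ a + u ≫ b = 0 := by rw [← ca, hab, z0]
  have h3 : u ≫ b + v ≫ b = 0 := by rw [← ac, huv, z1]
  have h4 : v ≫ b = u ≫ a := by
    calc v ≫ b = (u ≫ a + u ≫ b) + v ≫ b := by rw [h2, zero_add]
      _ = u ≫ a := by rw [add_assoc, h3, add_zero]
  rw [h4] at h1
  -- `n` is the negative of the identity of `K`
  obtain ⟨n, hn⟩ : ∃ n, n = u ≫ b + u ≫ b := ⟨_, rfl⟩
  have hn1 : n + 𝟙 K = 0 := by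
    rw [hn, ← h1, add_add_add_comm, add_comm (u ≫ b), h2, add_zero]
  have han : a ≫ n = b := by
    have h5 : a ≫ n + a = 0 := by
      calc a ≫ n + a = a ≫ n + a ≫ 𝟙 K := by rw [Category.comp_id]
        _ = 0 := by rw [← ca, hn1, z0]
    calc a ≫ n = a ≫ n + (a + b) := by rw [hab, add_zero]
      _ = b := by rw [← add_assoc, h5, zero_add]
  obtain ⟨e, he⟩ : ∃ e, e = a ≫ u + a ≫ u := ⟨_, rfl⟩
  have hea : e ≫ a = a := by
    rw [he, ac, Category.assoc, ← ca, h1, Category.comp_id]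
  obtain ⟨z, hz₁, hz₂⟩ := hP.exists_lift (𝟙 X) e
  have hzk : z ≫ adj k = 0 := by
    rw [hk', ca, ← Category.assoc, ← Category.assoc, hz₁, hz₂, Category.id_comp, ← han,
      ← Category.assoc, hea, han, hab]
  obtain ⟨y, hy⟩ := key z hzk
  have he1 : e = 𝟙 X := by
    have hy₁ : y = 𝟙 X := by rw [← hz₁, ← hy, Category.assoc, hd₁, Category.comp_id]
    rw [← hz₂, ← hy, Category.assoc, hd₂, Category.comp_id, hy₁]
  refine ⟨a ≫ n ≫ u + a ≫ n ≫ u, ?_⟩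
  change (a ≫ n ≫ u + a ≫ n ≫ u) + 𝟙 X = 0
  have h6 : a ≫ n ≫ u + a ≫ u = 0 := by
    calc a ≫ n ≫ u + a ≫ u = a ≫ ((n + 𝟙 K) ≫ u) := by rw [ac, ca, Category.id_comp]
      _ = 0 := by rw [hn1, z1, z0]
  rw [← he1, he, add_add_add_comm, h6, add_zero]

/-- The canonical abelian group structure on the hom-sets of a pre-Hilbert ∗-category. -/
noncomputable abbrev homAddCommGroup (X Y : C) : AddCommGroup (X ⟶ Y) :=
  letI (Z : C) : AddCommMonoid (X ⟶ Z) := homAddCommMonoid X Z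
  letI : Neg (X ⟶ Y) := ⟨fun f => (exists_neg_id X).choose ≫ f⟩
  { homAddCommMonoid X Y with
    neg := fun f => (exists_neg_id X).choose ≫ f
    zsmul := zsmulRec
    neg_add_cancel := fun f => by
      have h : (exists_neg_id X).choose + 𝟙 X = 0 := (exists_neg_id X).choose_spec
      have h' : (exists_neg_id X).choose ≫ f + 𝟙 X ≫ f = 0 := by
        rw [← SemiadditiveOfBinaryBiproducts.add_comp, h, zero_comp]
      rwa [Category.id_comp] at h' }

/-- The canonical enrichment of a pre-Hilbert ∗-category in abelian groups. -/
noncomputable instance instPreadditive : Preadditive C where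
  homGroup X Y := homAddCommGroup X Y
  add_comp _ _ _ f g h := SemiadditiveOfBinaryBiproducts.add_comp f g h
  comp_add _ _ _ f g h := SemiadditiveOfBinaryBiproducts.comp_add f g h

end Additive

/-! ### Order, inner products and order sums -/

section Order

variable {C : Type u} [Category.{v} C] [PreHilbertStarCategory C]

/-- The order on (Hermitian) endomorphisms: `f ≤ g` if and only if `g - f = h* h` for some
morphism `h : A ⟶ X`. -/
def HomLE {A : C} (f g : A ⟶ A) : Prop :=
  ∃ (X : C) (h : A ⟶ X), g - f = h ≫ adj h

/-- A family of endomorphisms is bounded above. (If the family is non-empty and consists of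
Hermitian morphisms, then every upper bound is Hermitian.) -/
def IsBoundedAbove {A : C} {ι : Type w} (a : ι → (A ⟶ A)) : Prop :=
  ∃ b : A ⟶ A, ∀ i, HomLE (a i) b

/-- `s` is the supremum of the family `a`. -/
def IsSupremum {A : C} {ι : Type w} (a : ι → (A ⟶ A)) (s : A ⟶ A) : Prop :=
  (∀ i, HomLE (a i) s) ∧ ∀ b : A ⟶ A, (∀ i, HomLE (a i) b) → HomLE s b

/-- A contraction: `f* f ≤ 1`. -/
def IsContraction {X Y : C} (f : X ⟶ Y) : Prop := HomLE (f ≫ adj f) (𝟙 X)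

/-- The inner product `⟨f, g⟩ = f* g` on `C(A, X)`, with values in `C(A, A)`. -/
def homInner {A X : C} (f g : A ⟶ X) : A ⟶ A := g ≫ adj f

/-- The net `F ↦ ∑_{j ∈ F} g_j* g_j` indexed by the finite subsets `F` of `J`. -/
noncomputable def partialSums {J : Type w} {Y : C} {X : J → C} (g : ∀ j, Y ⟶ X j) :
    Finset J → (Y ⟶ Y) :=
  fun F => ∑ j ∈ F, homInner (g j) (g j)

/-- Orthogonal families in the inner product `C(A, A)`-module `C(A, X)`. -/
def IsOrthogonalFamily {J : Type w} {A X : C} (x : J → (A ⟶ X)) : Prop :=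
  ∀ j k, j ≠ k → homInner (x j) (x k) = 0

/-- `ℓ²`-families in the inner product `C(A, A)`-module `C(A, X)`. -/
def IsL2Family {J : Type w} {A X : C} (x : J → (A ⟶ X)) : Prop :=
  IsOrthogonalFamily x ∧ IsBoundedAbove (partialSums x)

/-- `s` is an order sum of the (orthogonal) family `x`. -/
def IsOrderSum {J : Type w} {A X : C} (x : J → (A ⟶ X)) (s : A ⟶ X) : Prop :=
  (∀ j, homInner s (x j) = homInner (x j) (x j)) ∧ IsSupremum (partialSums x) (homInner s s)

end Order

/-- Orthogonal completeness: every `ℓ²`-family of parallel morphisms has an order sum. -/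
def IsOrthogonallyComplete (C : Type u) [Category.{v} C] [PreHilbertStarCategory C] : Prop :=
  ∀ (A X : C) (J : Type w) (x : J → (A ⟶ X)), IsL2Family x → ∃ s : A ⟶ X, IsOrderSum x s

/-! ### `ℓ²`-products -/

section L2Products

variable {C : Type u} [Category.{v} C] [PreHilbertStarCategory C]

/-- `ℓ²`-spans on the family `X`. -/
def IsL2Span {J : Type w} {X : J → C} {Y : C} (g : ∀ j, Y ⟶ X j) : Prop :=
  IsBoundedAbove (partialSums g)

/-- `(r_j : P ⟶ X_j)` is an `ℓ²`-product of the family `X`. -/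
def IsL2Product {J : Type w} {X : J → C} {P : C} (r : ∀ j, P ⟶ X j) : Prop :=
  IsL2Span r ∧ ∀ (Y : C) (g : ∀ j, Y ⟶ X j), IsL2Span g →
    ∃ m : Y ⟶ P, (∀ j, m ≫ r j = g j) ∧ (∀ m' : Y ⟶ P, (∀ j, m' ≫ r j = g j) → m' = m) ∧
      IsSupremum (partialSums g) (homInner m m)

end L2Products

/-- Every (set-indexed) family of objects has an `ℓ²`-product. -/
def HasL2Products (C : Type u) [Category.{v} C] [PreHilbertStarCategory C] : Prop :=
  ∀ (J : Type w) (X : J → C), ∃ (P : C) (r : ∀ j, P ⟶ X j), IsL2Product r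

/-! ### Codirected `ℓ²`-limits and Hilbert ∗-categories -/

section L2Limits

variable {C : Type u} [Category.{v} C] [PreHilbertStarCategory C]
variable {J : Type w} [Preorder J]

/-- `ℓ²`-cones on a codirected diagram `D` (of contractions). -/
def IsL2Cone {D : Jᵒᵖ ⥤ C} (c : Cone D) : Prop :=
  IsBoundedAbove fun j : J => homInner (c.π.app (Opposite.op j)) (c.π.app (Opposite.op j))

/-- `ℓ²`-limits of a codirected diagram `D` (of contractions). -/
def IsL2Limit {D : Jᵒᵖ ⥤ C} (c : Cone D) : Prop :=
  IsL2Cone c ∧ ∀ c' : Cone D, IsL2Cone c' →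
    ∃ m : c'.pt ⟶ c.pt, (∀ j, m ≫ c.π.app j = c'.π.app j) ∧
      (∀ m' : c'.pt ⟶ c.pt, (∀ j, m' ≫ c.π.app j = c'.π.app j) → m' = m) ∧
      IsSupremum
        (fun j : J => homInner (c'.π.app (Opposite.op j)) (c'.π.app (Opposite.op j)))
        (homInner m m)

end L2Limits

/-- A Hilbert ∗-category: a pre-Hilbert ∗-category that has `ℓ²`-limits of all codirected
diagrams of contractions (indexed by a non-empty directed preordered set). -/
def IsHilbertStarCategory (C : Type u) [Category.{v} C] [PreHilbertStarCategory C] : Prop :=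
  ∀ (J : Type w) [Preorder J] [IsDirectedOrder J] [Nonempty J] (D : Jᵒᵖ ⥤ C),
    (∀ (i j : Jᵒᵖ) (f : i ⟶ j), IsContraction (D.map f)) → ∃ c : Cone D, IsL2Limit c

end HilbertStar

open HilbertStar

namespace HilbertStar

open StarCategory

variable {C : Type u} [Category.{v} C] [PreHilbertStarCategory C]

/-! ### Additivity of the involution and definiteness -/

/-! In usual composition order: `exists_isometric_image` factors an orthogonal family as `x_j = k_j
y_j`, with `k_j : Z_j ⟶ X` isometries having pairwise orthogonal ranges. Let `L` be the ℓ²-product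
of the `Z_j`, with projections `r_j`. The `y_j` have the same partial sums as the `x_j`, so they
induce `m : A ⟶ L` with `m* m` the required supremum. The `k_j*` have partial sums that are
projections, bounded by `1`, so they induce a contraction `l : X ⟶ L`. The order sum is `l* m`.

The point is that `l` is coisometric and `l k_j = r_j*` (`coisometric_of_components`). Since `l k_j`
is a contractive right inverse of the contraction `r_j`, it equals `r_j*` by
`IsContraction.eq_adj_of_comp_eq_id`, a consequence of definiteness.

For Hilbert ∗-categories no ℓ²-product is formed: the same argument runs with `L` the ℓ²-limit of
the ranges of the finite partial sums of the projections `k_j k_j*`. -/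

theorem adj_add {X Y : C} (f g : X ⟶ Y) : adj (f + g) = adj f + adj g := by
  obtain ⟨P, p, q, hP⟩ := PreHilbertStarCategory.exists_orthonormalProduct Y Y
  have e11 : adj p ≫ p = 𝟙 Y := hP.fst_coisometric
  have e22 : adj q ≫ q = 𝟙 Y := hP.snd_coisometric
  -- Every sum `f + g` is `p + q` after the pairing of `f` and `g`, so this universal case suffices;
  -- both sides have both components `1`.
  have key : adj (p + q) = adj p + adj q := by
    apply hP.hom_ext
    · apply adj_injective
      rw [adj_comp, adj_adj, Preadditive.comp_add, Preadditive.add_comp, e11, hP.orthogonal',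
        hP.orthogonal]
      erw [add_zero]
      rw [adj_id]
    · apply adj_injective
      rw [adj_comp, adj_adj, Preadditive.comp_add, Preadditive.add_comp, e22, hP.orthogonal',
        hP.orthogonal]
      erw [zero_add]
      rw [adj_id]
  obtain ⟨l, rfl, rfl⟩ := hP.exists_lift f g
  rw [← Preadditive.comp_add, adj_comp, key, Preadditive.add_comp, adj_comp, adj_comp]

/-- The involution as a homomorphism of abelian groups. -/
noncomputable def adjHom (X Y : C) : (X ⟶ Y) →+ (Y ⟶ X) := AddMonoidHom.mk' adj adj_add

theorem adj_sub {X Y : C} (f g : X ⟶ Y) : adj (f - g) = adj f - adj g :=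
  (adjHom X Y).map_sub f g

theorem adj_sum {ι : Type*} {X Y : C} (s : Finset ι) (f : ι → (X ⟶ Y)) :
    adj (∑ i ∈ s, f i) = ∑ i ∈ s, adj (f i) :=
  map_sum (adjHom X Y) f s

theorem adj_eq_zero {X Y : C} {f : X ⟶ Y} (h : adj f = 0) : f = 0 := by
  apply adj_injective
  rw [h]
  exact ((adjHom X Y).map_zero).symm

theorem IsKernelOf.exists_lift {K X Y Z : C} {k : K ⟶ X} {f : X ⟶ Y} (hk : IsKernelOf k f)
    (g : Z ⟶ X) (hg : g ≫ f = 0) : ∃ l : Z ⟶ K, l ≫ k = g := by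
  obtain ⟨w, ⟨h⟩⟩ := hk
  obtain ⟨l, hl⟩ := KernelFork.IsLimit.lift' h g hg
  exact ⟨l, hl⟩

theorem IsKernelOf.exists_isometric {X Y : C} (f : X ⟶ Y) :
    ∃ (K : C) (k : K ⟶ X), k ≫ adj k = 𝟙 K ∧ k ≫ f = 0 ∧
      ∀ (Z : C) (g : Z ⟶ X), g ≫ f = 0 → ∃ l : Z ⟶ K, l ≫ k = g := by
  obtain ⟨K, k, hk, hkf⟩ := PreHilbertStarCategory.exists_isometric_kernel f
  obtain ⟨w, _⟩ := id hkf
  exact ⟨K, k, hk, w, fun Z g hg => hkf.exists_lift g hg⟩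

/-- Here `h` factors as `k t` through the isometric kernel `k` of `h*`, and then `0 = h* k = t* k* k
= t*`. -/
theorem eq_zero_of_comp_adj_self {A X : C} {h : A ⟶ X} (hh : h ≫ adj h = 0) : h = 0 := by
  obtain ⟨K, k, hk, hkh, hlift⟩ := IsKernelOf.exists_isometric (adj h)
  obtain ⟨t, ht⟩ := hlift A h hh
  have h0 : t = 0 := by
    apply adj_eq_zero
    rw [← hkh, ← ht, adj_comp, ← Category.assoc, hk, Category.id_comp]
  rw [← ht, h0, zero_comp]

/-- The sum is `l* l` for the pairing `l` of `a` and `b` into an orthonormal product, so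
definiteness applies to `l`. -/
theorem eq_zero_of_comp_adj_self_add {A X Y : C} {a : A ⟶ X} {b : A ⟶ Y}
    (hab : a ≫ adj a + b ≫ adj b = 0) : a = 0 := by
  obtain ⟨P, p, q, hP⟩ := PreHilbertStarCategory.exists_orthonormalProduct X Y
  have e11 : adj p ≫ p = 𝟙 X := hP.fst_coisometric
  have e22 : adj q ≫ q = 𝟙 Y := hP.snd_coisometric
  have e12 : adj p ≫ q = 0 := hP.orthogonal'
  have e21 : adj q ≫ p = 0 := hP.orthogonal
  set l : A ⟶ P := a ≫ adj p + b ≫ adj q with hl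
  have hlp : l ≫ p = a := by
    rw [hl, Preadditive.add_comp, Category.assoc, Category.assoc, e11, e21, Category.comp_id]
    erw [comp_zero, add_zero]
  have hlq : l ≫ q = b := by
    rw [hl, Preadditive.add_comp, Category.assoc, Category.assoc, e12, e22, Category.comp_id]
    erw [comp_zero, zero_add]
  have hll : l ≫ adj l = 0 := by
    have : adj l = p ≫ adj a + q ≫ adj b := by
      rw [hl, adj_add, adj_comp, adj_comp, adj_adj, adj_adj]
    rw [this, Preadditive.comp_add, ← Category.assoc, ← Category.assoc, hlp, hlq, hab]
  rw [← hlp, eq_zero_of_comp_adj_self hll, zero_comp]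

/-! ### The order -/

theorem HomLE.conj {A B : C} {f g : A ⟶ A} (h : HomLE f g) (t : B ⟶ A) :
    HomLE (t ≫ f ≫ adj t) (t ≫ g ≫ adj t) := by
  obtain ⟨X, a, ha⟩ := h
  refine ⟨X, t ≫ a, ?_⟩
  rw [adj_comp, Category.assoc, ← Category.assoc a, ← ha, Preadditive.sub_comp,
    Preadditive.comp_sub]

/-- A projection is at most the identity. -/
theorem homLE_id_of_projection {X : C} {p : X ⟶ X} (hp : adj p = p) (hpp : p ≫ p = p) :
    HomLE p (𝟙 X) := by
  refine ⟨X, 𝟙 X - p, ?_⟩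
  rw [adj_sub, adj_id, hp, Preadditive.comp_sub, Preadditive.sub_comp, Preadditive.sub_comp, hpp]
  simp

/-- A contractive right inverse of a contraction is its adjoint. -/
theorem IsContraction.eq_adj_of_comp_eq_id {L Z : C} {f : L ⟶ Z} {i : Z ⟶ L}
    (hf : IsContraction f) (hi : IsContraction i) (hif : i ≫ f = 𝟙 Z) : i = adj f := by
  obtain ⟨X, h, hh⟩ := hf
  obtain ⟨Y, g, hg⟩ := hi
  have hfi : adj f ≫ adj i = 𝟙 Z := by rw [← adj_comp, hif, adj_id]
  -- With `h* h = 1 - f* f`, `g* g = 1 - i* i` and `f i = 1`, one gets `(h i)* (h i) + g* g = (i* i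
  -- - 1) + (1 - i* i) = 0`.
  have h0 : i ≫ h = 0 := by
    apply eq_zero_of_comp_adj_self_add (b := g)
    rw [adj_comp, Category.assoc, ← Category.assoc h, ← hh, ← hg, Preadditive.sub_comp,
      Preadditive.comp_sub, Category.id_comp, Category.assoc, hfi, Category.comp_id, hif]
    abel
  have h1 : i ≫ (𝟙 L - f ≫ adj f) = 0 := by rw [hh, ← Category.assoc, h0, zero_comp]
  rw [Preadditive.comp_sub, ← Category.assoc, hif, Category.comp_id, Category.id_comp,
    sub_eq_zero] at h1
  exact h1

/-- Every morphism factors as a morphism with dense image followed by an isometry. -/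
theorem exists_isometric_image {A X : C} (x : A ⟶ X) :
    ∃ (K : C) (y : A ⟶ K) (k : K ⟶ X), k ≫ adj k = 𝟙 K ∧ y ≫ k = x ∧
      ∀ (Z : C) (g : K ⟶ Z), y ≫ g = 0 → g = 0 := by
  -- `K` is the double orthogonal complement of the range of `x`: the kernel of `c*`, where `c` is
  -- the kernel of `x*`.
  obtain ⟨K', c, hc, hcx, hlift⟩ := IsKernelOf.exists_isometric (adj x)
  obtain ⟨K, k, hk, hkc, hlift'⟩ := IsKernelOf.exists_isometric (adj c)
  obtain ⟨y, hy⟩ := hlift' A x (adj_eq_zero (by rw [adj_comp, adj_adj, hcx]))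
  refine ⟨K, y, k, hk, hy, fun Z g hg => adj_eq_zero ?_⟩
  -- If `g y = 0`, then `k g*` lands in the kernel `c` of `x*`; it also lands in the range of `k`,
  -- which is orthogonal to `c`, so it vanishes.
  have h1 : (adj g ≫ k) ≫ adj x = 0 := by
    rw [← hy, adj_comp, Category.assoc, ← Category.assoc k, hk, Category.id_comp, ← adj_comp, hg]
    exact (adjHom A Z).map_zero
  obtain ⟨t, ht⟩ := hlift Z _ h1
  have ht0 : t = 0 := by
    rw [← Category.comp_id t, ← hc, ← Category.assoc, ht, Category.assoc, hkc]
    exact comp_zero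
  rw [← Category.comp_id (adj g), ← hk, ← Category.assoc, ← ht, ht0, zero_comp]
  exact zero_comp

/-- Projections split through isometries. -/
theorem exists_isometric_splitting {X : C} {p : X ⟶ X} (hp : adj p = p) (hpp : p ≫ p = p) :
    ∃ (K : C) (k : K ⟶ X), k ≫ adj k = 𝟙 K ∧ adj k ≫ k = p := by
  -- The range of a projection is its fixed space, the kernel of `1 - p`.
  obtain ⟨K, k, hk, hkp, hlift⟩ := IsKernelOf.exists_isometric (𝟙 X - p)
  rw [Preadditive.comp_sub, Category.comp_id, sub_eq_zero] at hkp
  obtain ⟨t, ht⟩ := hlift X p (by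
    rw [Preadditive.comp_sub, Category.comp_id, hpp, sub_self])
  have htk : t = adj k := by
    rw [← Category.comp_id t, ← hk, ← Category.assoc, ht]
    nth_rewrite 1 [← hp]
    rw [← adj_comp, ← hkp]
  exact ⟨K, k, hk, htk ▸ ht⟩

/-- Let `k : X ⟶ L` be a contraction whose components along jointly monic contractions `f i`
are adjoint to isometries `K i`. Then `k` is coisometric and `k (K i) = (f i)*`. -/
theorem coisometric_of_components {I : Type*} {X L : C} {Z : I → C} {f : ∀ i, L ⟶ Z i}
    {K : ∀ i, Z i ⟶ X} {k : X ⟶ L} (hf : ∀ i, IsContraction (f i))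
    (hmono : ∀ m : L ⟶ L, (∀ i, m ≫ f i = f i) → m = 𝟙 L)
    (hK : ∀ i, K i ≫ adj (K i) = 𝟙 (Z i)) (hk : IsContraction k)
    (hkf : ∀ i, k ≫ f i = adj (K i)) :
    (∀ i, K i ≫ k = adj (f i)) ∧ adj k ≫ k = 𝟙 L := by
  have h1 : ∀ i, K i ≫ k = adj (f i) := fun i => by
    refine (hf i).eq_adj_of_comp_eq_id ?_ (by rw [Category.assoc, hkf, hK])
    have := hk.conj (K i)
    rw [Category.id_comp, hK] at this
    rwa [IsContraction, adj_comp, Category.assoc, ← Category.assoc k]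
  -- `k k*` has the same components as `1`: `f_i k k* = (K_i)* k* = (k K_i)* = f_i`.
  refine ⟨h1, hmono _ fun i => ?_⟩
  rw [Category.assoc, hkf, ← adj_comp, h1, adj_adj]

/-! ### Orthogonal families of isometries -/

section Projections

variable {J : Type w} {X : C} {Z : J → C} {k : ∀ j, Z j ⟶ X}

theorem adj_sum_range_projections (F : Finset J) :
    adj (∑ j ∈ F, adj (k j) ≫ k j) = ∑ j ∈ F, adj (k j) ≫ k j := by
  rw [adj_sum]
  exact Finset.sum_congr rfl fun j _ => by rw [adj_comp, adj_adj]

theorem comp_sum_range_projections (hk : ∀ j, k j ≫ adj (k j) = 𝟙 (Z j))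
    (hort : ∀ i j, i ≠ j → k i ≫ adj (k j) = 0) {F : Finset J} {i : J} (hi : i ∈ F) :
    k i ≫ ∑ j ∈ F, adj (k j) ≫ k j = k i := by
  rw [Preadditive.comp_sum, Finset.sum_eq_single_of_mem i hi]
  · rw [← Category.assoc, hk, Category.id_comp]
  · intro j _ hj
    rw [← Category.assoc, hort i j hj.symm]
    exact zero_comp

theorem sum_range_projections_comp_of_subset (hk : ∀ j, k j ≫ adj (k j) = 𝟙 (Z j))
    (hort : ∀ i j, i ≠ j → k i ≫ adj (k j) = 0) {F G : Finset J} (hFG : F ⊆ G) :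
    (∑ j ∈ F, adj (k j) ≫ k j) ≫ ∑ j ∈ G, adj (k j) ≫ k j = ∑ j ∈ F, adj (k j) ≫ k j := by
  rw [Preadditive.sum_comp]
  refine Finset.sum_congr rfl fun j hj => ?_
  rw [Category.assoc, comp_sum_range_projections hk hort (hFG hj)]

theorem sum_range_projections_le_id (hk : ∀ j, k j ≫ adj (k j) = 𝟙 (Z j))
    (hort : ∀ i j, i ≠ j → k i ≫ adj (k j) = 0) (F : Finset J) :
    HomLE (∑ j ∈ F, adj (k j) ≫ k j) (𝟙 X) :=
  homLE_id_of_projection (adj_sum_range_projections F)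
    (sum_range_projections_comp_of_subset hk hort subset_rfl)

end Projections

/-- An orthogonal family factors through an orthogonal family of isometries. -/
theorem IsOrthogonalFamily.exists_factorization {J : Type w} {A X : C} {x : J → (A ⟶ X)}
    (hx : IsOrthogonalFamily x) :
    ∃ (Z : J → C) (y : ∀ j, A ⟶ Z j) (k : ∀ j, Z j ⟶ X), (∀ j, k j ≫ adj (k j) = 𝟙 (Z j)) ∧
      (∀ j, y j ≫ k j = x j) ∧ ∀ i j, i ≠ j → k i ≫ adj (k j) = 0 := by
  choose Z y k hk hy hd using fun j => exists_isometric_image (x j)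
  -- Density cancels `y_i` on one side and, after taking adjoints, `y_j` on the other, reducing
  -- orthogonality of the ranges to that of `x_i` and `x_j`.
  refine ⟨Z, y, k, hk, hy, fun i j hij => hd i _ _ (adj_eq_zero (hd j _ _ ?_))⟩
  have h : x i ≫ adj (x j) = 0 := hx j i hij.symm
  have e : y j ≫ adj (y i ≫ k i ≫ adj (k j)) = adj (x i ≫ adj (x j)) := by
    rw [← hy i, ← hy j]
    simp only [adj_comp, adj_adj, Category.assoc]
  rw [e, h]
  exact (adjHom A A).map_zero

theorem homInner_id (X : C) : homInner (𝟙 X) (𝟙 X) = 𝟙 X := by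
  rw [homInner, adj_id, Category.id_comp]

theorem homInner_comp_isometric {A K X : C} {y : A ⟶ K} {k : K ⟶ X} (hk : k ≫ adj k = 𝟙 K) :
    homInner (y ≫ k) (y ≫ k) = homInner y y := by
  rw [homInner, homInner, adj_comp, Category.assoc, ← Category.assoc k, hk, Category.id_comp]

theorem homInner_comp_adj_coisometric {A L X : C} {m : A ⟶ L} {k : X ⟶ L}
    (hk : adj k ≫ k = 𝟙 L) : homInner (m ≫ adj k) (m ≫ adj k) = homInner m m :=
  homInner_comp_isometric (by rw [adj_adj, hk])

/-! ### Orthogonal completeness -/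

theorem HasL2Products.isOrthogonallyComplete (h : HasL2Products.{w} C) :
    IsOrthogonallyComplete.{w} C := by
  rintro A X J x ⟨hort, hbd⟩
  obtain ⟨Z, y, k, hk, hy, hkk⟩ := hort.exists_factorization
  obtain ⟨P, r, hr, huniv⟩ := h J Z
  have hps : partialSums y = partialSums x := funext fun F =>
    Finset.sum_congr rfl fun j _ => by rw [← hy j, homInner_comp_isometric (hk j)]
  have hpk : ∀ F, partialSums (fun j => adj (k j)) F = ∑ j ∈ F, adj (k j) ≫ k j := fun F =>
    Finset.sum_congr rfl fun j _ => by rw [homInner, adj_adj]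
  have hkle : ∀ F, HomLE (partialSums (fun j => adj (k j)) F) (𝟙 X) := fun F => by
    rw [hpk]
    exact sum_range_projections_le_id hk hkk F
  obtain ⟨m, hm, -, hmsup⟩ := huniv A y (by rwa [IsL2Span, hps])
  obtain ⟨l, hl, -, hlsup⟩ := huniv X (fun j => adj (k j)) ⟨𝟙 X, hkle⟩
  -- The span `r` induces the identity of `P`, so its partial sums have supremum `1`; the singleton
  -- sums show that each `r_j` is a contraction.
  obtain ⟨e, -, hu, hesup⟩ := huniv P r hr
  have he : e = 𝟙 P := (hu _ fun j => Category.id_comp _).symm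
  have hrc : ∀ j, IsContraction (r j) := fun j => by
    have := hesup.1 {j}
    rwa [partialSums, Finset.sum_singleton, he, homInner_id] at this
  obtain ⟨h1, h2⟩ := coisometric_of_components hrc (fun m' hm' => (hu m' hm').trans he) hk
    (hlsup.2 _ hkle) hl
  refine ⟨m ≫ adj l, fun j => ?_, ?_⟩
  · rw [← hy j, homInner_comp_isometric (hk j), homInner, homInner, adj_comp, adj_adj,
      Category.assoc, ← Category.assoc (k j), h1, ← adj_comp, hm]
  · rwa [homInner_comp_adj_coisometric h2, ← hps]

theorem IsHilbertStarCategory.isOrthogonallyComplete (h : IsHilbertStarCategory.{w} C) :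
    IsOrthogonallyComplete.{w} C := by
  classical
  rintro A X J x ⟨hort, hbd⟩
  obtain ⟨Z, y, k, hk, hy, hkk⟩ := hort.exists_factorization
  choose W K hK hKp using fun F : Finset J => exists_isometric_splitting
    (adj_sum_range_projections (k := k) F)
    (sum_range_projections_comp_of_subset hk hkk (subset_refl F))
  -- the ranges of `K F` increase with `F`
  have hmono : ∀ {F G : Finset J}, F ⊆ G → K F ≫ adj (K G) ≫ K G = K F := fun {F G} hFG => by
    have e : K F ≫ ∑ j ∈ F, adj (k j) ≫ k j = K F := by
      rw [← hKp, ← Category.assoc, hK, Category.id_comp]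
    rw [← e, Category.assoc, hKp, sum_range_projections_comp_of_subset hk hkk hFG]
  have hmono' : ∀ {F G : Finset J}, F ⊆ G → adj (K G) ≫ K G ≫ adj (K F) = adj (K F) :=
    fun {F G} hFG => by
      have := congrArg adj (hmono hFG)
      rwa [adj_comp, adj_comp, adj_adj, Category.assoc] at this
  have hxK : ∀ {j : J} {F : Finset J}, j ∈ F → x j ≫ adj (K F) ≫ K F = x j := fun {j F} hj => by
    rw [hKp, ← hy j, Category.assoc, comp_sum_range_projections hk hkk hj]
  have hKle : ∀ F, HomLE (adj (K F) ≫ K F) (𝟙 X) := fun F => by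
    rw [hKp]
    exact sum_range_projections_le_id hk hkk F
  -- For `G ⊆ F` the transition map is the orthogonal projection from the range `W F` onto the
  -- smaller range `W G`.
  let D : (Finset J)ᵒᵖ ⥤ C :=
    { obj := fun F => W F.unop
      map := fun {F G} _ => K F.unop ≫ adj (K G.unop)
      map_id := fun F => hK F.unop
      map_comp := fun {F G H} f g => by
        rw [Category.assoc, hmono' (leOfHom g.unop)] }
  have hD : ∀ (F G : (Finset J)ᵒᵖ) (f : F ⟶ G), IsContraction (D.map f) := fun F G f => by
    have := (hKle G.unop).conj (K F.unop)
    rw [Category.id_comp, hK] at this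
    change HomLE ((K F.unop ≫ adj (K G.unop)) ≫ adj (K F.unop ≫ adj (K G.unop))) _
    rwa [adj_comp, adj_adj, Category.assoc, ← Category.assoc (adj (K G.unop))]
  obtain ⟨c, hc, huniv⟩ := h (Finset J) D hD
  -- the cone of orthogonal projections of `X`
  let cX : Cone D :=
    { pt := X
      π :=
        { app := fun F => adj (K F.unop)
          naturality := fun F G f =>
            (Category.id_comp _).trans (hmono' (leOfHom f.unop)).symm } }
  have hcX : ∀ F : Finset J, HomLE (homInner (cX.π.app (Opposite.op F))
      (cX.π.app (Opposite.op F))) (𝟙 X) := fun F => by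
    change HomLE (adj (K F) ≫ adj (adj (K F))) _
    rw [adj_adj]
    exact hKle F
  -- the cone of partial sums of `x`
  have hxadj : ∀ {F G : Finset J}, F ⊆ G →
      (∑ j ∈ G, x j) ≫ adj (K F) = (∑ j ∈ F, x j) ≫ adj (K F) := fun {F G} hFG => by
    rw [Preadditive.sum_comp, Preadditive.sum_comp]
    refine (Finset.sum_subset hFG fun j _ hj => ?_).symm
    -- Terms with index outside `F` are orthogonal to the range of `K F`, so enlarging the sum does
    -- not change its projection there.
    have h0 : x j ≫ ∑ i ∈ F, adj (k i) ≫ k i = 0 := by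
      rw [← hy j, Category.assoc, Preadditive.comp_sum, Finset.sum_eq_zero]
      · exact comp_zero
      · intro i hi
        rw [← Category.assoc, hkk j i (fun e => hj (e ▸ hi))]
        exact zero_comp
    rw [← hmono' (subset_refl F), ← Category.assoc (adj (K F)), hKp, ← Category.assoc, h0]
    exact zero_comp
  let cA : Cone D :=
    { pt := A
      π :=
        { app := fun F => (∑ j ∈ F.unop, x j) ≫ adj (K F.unop)
          naturality := fun F G f => by
            change 𝟙 A ≫ (∑ j ∈ G.unop, x j) ≫ adj (K G.unop) =
              ((∑ j ∈ F.unop, x j) ≫ adj (K F.unop)) ≫ K F.unop ≫ adj (K G.unop)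
            rw [Category.id_comp, Category.assoc, hmono' (leOfHom f.unop),
              hxadj (leOfHom f.unop)] } }
  have hsumK : ∀ F : Finset J, (∑ j ∈ F, x j) ≫ adj (K F) ≫ K F = ∑ j ∈ F, x j := fun F => by
    rw [Preadditive.sum_comp]
    exact Finset.sum_congr rfl fun j hj => hxK hj
  have hsum : ∀ {F : Finset J} {j : J}, j ∈ F →
      x j ≫ adj (∑ i ∈ F, x i) = x j ≫ adj (x j) := fun {F j} hj => by
    rw [adj_sum, Preadditive.comp_sum]
    exact Finset.sum_eq_single_of_mem j hj fun i _ hij => hort i j hij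
  -- The partial sum over `F` already lies in the range of `K F`, so projecting preserves its inner
  -- square, in which the cross terms vanish by orthogonality.
  have hcA : (fun F : Finset J => homInner (cA.π.app (Opposite.op F))
      (cA.π.app (Opposite.op F))) = partialSums x := funext fun F => by
    change ((∑ j ∈ F, x j) ≫ adj (K F)) ≫ adj ((∑ j ∈ F, x j) ≫ adj (K F)) = _
    rw [adj_comp, adj_adj, Category.assoc, ← Category.assoc (adj (K F)), ← Category.assoc,
      hsumK, Preadditive.sum_comp]
    exact Finset.sum_congr rfl fun j hj => hsum hj
  obtain ⟨m, hm, -, hmsup⟩ := huniv cA (by rwa [IsL2Cone, hcA])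
  obtain ⟨l, hl, -, hlsup⟩ := huniv cX ⟨𝟙 X, hcX⟩
  obtain ⟨e, -, hu, hesup⟩ := huniv c hc
  have he : e = 𝟙 c.pt := (hu _ fun j => Category.id_comp _).symm
  have hcc : ∀ F : Finset J, IsContraction (c.π.app (Opposite.op F)) := fun F => by
    have : HomLE (A := c.pt) (homInner (c.π.app (Opposite.op F)) (c.π.app (Opposite.op F)))
      (homInner (A := c.pt) (X := c.pt) e e) := hesup.1 F
    rw [he, homInner_id] at this
    exact this
  obtain ⟨h1, h2⟩ := coisometric_of_components (Z := W) (K := K) hcc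
    (fun m' hm' => (hu m' fun F => hm' F.unop).trans he) hK (hlsup.2 _ hcX)
    (fun F => hl (Opposite.op F))
  refine ⟨m ≫ adj l, fun j => ?_, ?_⟩
  -- Since `x_j` lies in the range of `K {j}`, only the component at the singleton `{j}` matters.
  · have hmj : m ≫ c.π.app (Opposite.op {j}) = (∑ i ∈ {j}, x i) ≫ adj (K {j}) :=
      hm (Opposite.op {j})
    have hj : j ∈ ({j} : Finset J) := Finset.mem_singleton_self j
    calc x j ≫ adj (m ≫ adj l)
        = (x j ≫ adj (K {j}) ≫ K {j}) ≫ l ≫ adj m := by rw [hxK hj, adj_comp, adj_adj]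
      _ = x j ≫ adj (K {j}) ≫ adj (m ≫ c.π.app (Opposite.op {j})) := by
        rw [adj_comp, ← h1]
        simp only [Category.assoc]
      _ = (x j ≫ adj (K {j}) ≫ K {j}) ≫ adj (∑ i ∈ {j}, x i) := by
        rw [hmj, adj_comp, adj_adj]
        simp only [Category.assoc]
      _ = x j ≫ adj (x j) := by rw [hxK hj, hsum hj]
  · rw [homInner_comp_adj_coisometric h2, ← hcA]
    exact hmsup

end HilbertStar

theorem mainTheorem3 (C : Type u) [Category.{v} C] [PreHilbertStarCategory C] :
    (HasL2Products.{w} C → IsOrthogonallyComplete.{w} C) ∧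
      (IsHilbertStarCategory.{w} C → IsOrthogonallyComplete.{w} C) :=
  ⟨HasL2Products.isOrthogonallyComplete, IsHilbertStarCategory.isOrthogonallyComplete⟩
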